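/- Let $S$ be a semitopological semigroup (a semigroup with a topology for which all left and all right translations are continuous), and let $C(S)$ be the $C^*$-algebra of bounded continuous functions $S\to\mathbb C$ with the sup norm. For $f\in C(S)$ and $s\in S$ put $(L_sf)(t)=f(st)$. Let $$LMC(S)=\{f\in C(S): s\mapsto\mu(L_sf)\text{ is continuous on } S \text{ for every } \mu \text{ in the spectrum of } C(S)\},$$ a left translation invariant unital $*$-subalgebra of $C(S)$, and let $S^{LMC}$ be its spectrum, that is, the set of nonzero continuous multiplicative linear functionals on $LMC(S)$. For $\mu\in S^{LMC}$ and $f\in LMC(S)$ put $(T_\mu f)(s)=\mu(L_sf)$, and let $\Sigma=\{T_\mu:\mu\in S^{LMC}\}$. Let $F_0$ be the set of all constant functions on $S$ of modulus $1$ and, for $k\ge 1$, $$F_k=\{f\in LMC(S): |f|=1 \text{ and for every } \sigma\in\Sigma \text{ there is } f_\sigma\in F_{k-1} \text{ with } \sigma(f)=f_\sigma f\}.$$ For $k\ge1$, let $W_k(S)$ be the norm closure in $C(S)$ of the algebra generated by $F_k$, and let $W(S)$ be the norm closure in $C(S)$ of the algebra generated by $\bigcup_{k\ge1}F_k$. Corollary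 3.8. For every compact abelian topological group $G$ and every integer $k\ge1$, $W_k(G)=W(G)=C(G)$. -/

import Mathlib

open scoped BoundedContinuousFunction

namespace WeylAlgebra

noncomputable section

/-! Throughout, `S` is a semitopological semigroup (multiplication is separately continuous), and
`C(S)` is the C⋆-algebra `S →ᵇ ℂ` of bounded continuous complex functions with the sup norm. -/

/-- The left translation `L_s f = f ∘ l_s`, that is `(L_s f)(t) = f (s * t)`, on `C(S)`. -/
def leftTranslate {S : Type*} [Semigroup S] [TopologicalSpace S] [SeparatelyContinuousMul S]
    (s : S) (f : S →ᵇ ℂ) : S →ᵇ ℂ :=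
  f.compContinuous ⟨fun t => s * t, continuous_const_mul s⟩

theorem leftTranslate_leftTranslate {S : Type*} [Semigroup S] [TopologicalSpace S]
    [SeparatelyContinuousMul S] (s t : S) (f : S →ᵇ ℂ) :
    leftTranslate s (leftTranslate t f) = leftTranslate (t * s) f := by
  ext x
  exact congrArg f (mul_assoc t s x).symm

/-- The left multiplicatively continuous functions `LMC(S)`: those `f ∈ C(S)` for which
`s ↦ μ (L_s f)` is continuous for every `μ` in the spectrum (the Gelfand space) of `C(S)`. -/
def LMC (S : Type*) [Semigroup S] [TopologicalSpace S] [SeparatelyContinuousMul S] :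
    StarSubalgebra ℂ (S →ᵇ ℂ) where
  carrier := {f | ∀ μ : WeakDual.characterSpace ℂ (S →ᵇ ℂ),
    Continuous fun s : S => μ (leftTranslate s f)}
  mul_mem' {f g} hf hg μ := by
    have h : ∀ s, μ (leftTranslate s (f * g)) = μ (leftTranslate s f) * μ (leftTranslate s g) :=
      fun s => map_mul μ (leftTranslate s f) (leftTranslate s g)
    simp only [h]
    exact (hf μ).mul (hg μ)
  add_mem' {f g} hf hg μ := by
    have h : ∀ s, μ (leftTranslate s (f + g)) = μ (leftTranslate s f) + μ (leftTranslate s g) :=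
      fun s => map_add μ (leftTranslate s f) (leftTranslate s g)
    simp only [h]
    exact (hf μ).add (hg μ)
  algebraMap_mem' c μ := by
    have h : ∀ s : S, μ (leftTranslate s (algebraMap ℂ (S →ᵇ ℂ) c)) =
      μ (algebraMap ℂ (S →ᵇ ℂ) c) := fun s => rfl
    simpa only [h] using continuous_const
  star_mem' {f} hf μ := by
    have h : ∀ s, μ (leftTranslate s (star f)) = star (μ (leftTranslate s f)) :=
      fun s => map_star μ (leftTranslate s f)
    simpa only [h] using (hf μ).star

theorem leftTranslate_mem_LMC {S : Type*} [Semigroup S] [TopologicalSpace S]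
    [SeparatelyContinuousMul S] (s : S) {f : S →ᵇ ℂ} (hf : f ∈ LMC S) :
    leftTranslate s f ∈ LMC S := by
  intro μ
  simp only [leftTranslate_leftTranslate]
  exact (hf μ).comp (continuous_const_mul s)

/-- The function `T_μ f : s ↦ μ (L_s f)` for `f ∈ LMC(S)` and `μ` in the spectrum `S^LMC` of
`LMC(S)`. The set `Σ` consists of the operators `T_μ`, `μ ∈ S^LMC`. -/
def T {S : Type*} [Semigroup S] [TopologicalSpace S] [SeparatelyContinuousMul S]
    (μ : WeakDual.characterSpace ℂ (LMC S)) (f : LMC S) : S → ℂ :=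
  fun s => μ ⟨leftTranslate s f, leftTranslate_mem_LMC s f.2⟩

/-- The sets `F_k`: `F_0` consists of the constant functions of modulus `1`, and `F_{k+1}` of the
`f ∈ LMC(S)` with `|f| = 1` such that for every `σ ∈ Σ` one has `σ(f) = f_σ f` for some
`f_σ ∈ F_k`. -/
def F (S : Type*) [Semigroup S] [TopologicalSpace S] [SeparatelyContinuousMul S] :
    ℕ → Set (S →ᵇ ℂ)
  | 0 => {f | ∃ c : ℂ, ‖c‖ = 1 ∧ f = BoundedContinuousFunction.const S c}
  | k + 1 => {f | ∃ hf : f ∈ LMC S, (∀ s, ‖f s‖ = 1) ∧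
      ∀ μ : WeakDual.characterSpace ℂ (LMC S), ∃ g ∈ F S k, ∀ s, T μ ⟨f, hf⟩ s = g s * f s}

/-- `W_k(S)`: the norm closure in `C(S)` of the algebra generated by `F_k`
(which contains the constant function `1`). -/
def Wk (S : Type*) [Semigroup S] [TopologicalSpace S] [SeparatelyContinuousMul S] (k : ℕ) :
    Subalgebra ℂ (S →ᵇ ℂ) :=
  (Algebra.adjoin ℂ (F S k)).topologicalClosure

/-- `W(S)`: the norm closure in `C(S)` of the algebra generated by the union of the `F_k`,
`k ≥ 1`. -/
def W (S : Type*) [Semigroup S] [TopologicalSpace S] [SeparatelyContinuousMul S] :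
    Subalgebra ℂ (S →ᵇ ℂ) :=
  (Algebra.adjoin ℂ {f | ∃ k : ℕ, 1 ≤ k ∧ f ∈ F S k}).topologicalClosure

end

end WeylAlgebra

/-! A continuous function of modulus one with `f (s * t) = f s * f t` satisfies
`T μ f = μ f • f` with `|μ f| = 1`, so it lies in every `F_k`, `k ≥ 1`. It therefore suffices that
the characters of a compact abelian group span a dense subspace of `C(G)`, which by
Stone–Weierstrass means that they separate the points of `G` (up to inseparability, as `G` need not
be Hausdorff).

Averaging the rank one operators attached to an orbit `x ↦ π x v` of a unitary representation over
Haar measure gives a nonzero compact self-adjoint operator commuting with `π`. Its eigenspaces are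
finite-dimensional and invariant, so for abelian `G` they contain a common eigenvector of all `π x`,
whose eigenvalues form a character. If `π g ≠ 1`, doing this in the orthogonal complement of the
vectors fixed by `π g` gives a character with value `≠ 1` at `g`; the left regular representation
provides such a `π`. -/

open MeasureTheory InnerProductSpace
open scoped InnerProductSpace ENNReal

theorem exists_common_eigenvector_of_commute {K V ι : Type*} [Field K] [IsAlgClosed K]
    [AddCommGroup V] [Module K V] {T : ι → Module.End K V} (hT : ∀ i j, Commute (T i) (T j))
    {p : Submodule K V} [FiniteDimensional K p] (hp : p ≠ ⊥) (hpT : ∀ i, ∀ v ∈ p, T i v ∈ p) :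
    ∃ v ∈ p, v ≠ 0 ∧ ∀ i, ∃ c : K, T i v = c • v := by
  induction hn : Module.finrank K p using Nat.strong_induction_on generalizing p with
  | _ n ih
  by_cases hscalar : ∀ i, ∃ c : K, ∀ v ∈ p, T i v = c • v
  · obtain ⟨v, hv, hv0⟩ := p.exists_mem_ne_zero_of_ne_bot hp
    exact ⟨v, hv, hv0, fun i => (hscalar i).imp fun c hc => hc v hv⟩
  · push Not at hscalar
    obtain ⟨i, hi⟩ := hscalar
    have : Nontrivial p := p.nontrivial_iff_ne_bot.2 hp
    obtain ⟨c, hc⟩ := Module.End.exists_eigenvalue ((T i).restrict (hpT i))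
    obtain ⟨w, hw⟩ := hc.exists_hasEigenvector
    obtain ⟨u, hu, huc⟩ := hi c
    let q := p ⊓ (T i).eigenspace c
    have hqp : q < p := lt_of_le_of_ne inf_le_left fun h =>
      huc (Module.End.mem_eigenspace_iff.1 (inf_eq_left.1 h hu))
    have hq : q ≠ ⊥ := (Submodule.ne_bot_iff q).2 ⟨w, ⟨w.2, Module.End.mem_eigenspace_iff.2
      (congrArg Subtype.val hw.apply_eq_smul)⟩, fun h => hw.2 (Subtype.ext h)⟩
    have hqT : ∀ j, ∀ v ∈ q, T j v ∈ q := fun j v hv =>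
      ⟨hpT j v hv.1, Module.End.mapsTo_genEigenspace_of_comm (hT i j) c 1 hv.2⟩
    have : FiniteDimensional K q := Submodule.finiteDimensional_of_le hqp.le
    obtain ⟨v, hv, hv0, hvT⟩ := ih _ (hn ▸ Submodule.finrank_lt_finrank_of_lt hqp) hq hqT rfl
    exact ⟨v, hqp.le hv, hv0, hvT⟩

section FrameOperator

variable {X H : Type*} [TopologicalSpace X] [CompactSpace X] [MeasurableSpace X] [BorelSpace X]
  [NormedAddCommGroup H] [InnerProductSpace ℂ H]

/-- The frame operator `w ↦ ∫ ⟪u x, w⟫ • u x ∂μ` of a family `u` of vectors, as an operator-valued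
integral. It is used for orbits `u x = π x v` of unitary representations. -/
noncomputable def frameOperator (μ : Measure X) (u : X → H) : H →L[ℂ] H :=
  ∫ x, rankOne ℂ (u x) (u x) ∂μ

variable (μ : Measure X) {u : X → H}

theorem integrable_inner_smul [IsFiniteMeasureOnCompacts μ] (hu : Continuous u) (w : H) :
    Integrable (fun x => ⟪u x, w⟫_ℂ • u x) μ :=
  Continuous.integrable_of_hasCompactSupport (by fun_prop) (.of_compactSpace _)

theorem integrable_rankOne [IsFiniteMeasureOnCompacts μ] (hu : Continuous u) :
    Integrable (fun x => rankOne ℂ (u x) (u x)) μ := by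
  refine Continuous.integrable_of_hasCompactSupport ?_ (.of_compactSpace _)
  simp only [rankOne_def']
  exact ((ContinuousLinearMap.toSpanSingletonCLE (𝕜 := ℂ)).continuous.comp hu).clm_comp
    ((innerSL ℂ).continuous.comp hu)

theorem frameOperator_apply [IsFiniteMeasureOnCompacts μ] (hu : Continuous u) (w : H) :
    frameOperator μ u w = ∫ x, ⟪u x, w⟫_ℂ • u x ∂μ := by
  rw [frameOperator, ContinuousLinearMap.integral_apply (integrable_rankOne μ hu)]
  simp only [rankOne_apply]

theorem inner_frameOperator_apply [CompleteSpace H] [IsFiniteMeasureOnCompacts μ]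
    (hu : Continuous u) (w z : H) :
    ⟪z, frameOperator μ u w⟫_ℂ = ∫ x, ⟪u x, w⟫_ℂ * ⟪z, u x⟫_ℂ ∂μ := by
  rw [frameOperator_apply μ hu, ← integral_inner (integrable_inner_smul μ hu w)]
  simp only [inner_smul_right]

theorem isSymmetric_frameOperator [CompleteSpace H] [IsFiniteMeasureOnCompacts μ]
    (hu : Continuous u) : (frameOperator μ u : H →ₗ[ℂ] H).IsSymmetric := fun w z => by
  simp only [ContinuousLinearMap.coe_coe]
  rw [← inner_conj_symm, inner_frameOperator_apply μ hu, inner_frameOperator_apply μ hu,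
    ← integral_conj]
  simp only [map_mul, inner_conj_symm, mul_comm]

theorem frameOperator_ne_zero [CompleteSpace H] [IsFiniteMeasureOnCompacts μ] [μ.IsOpenPosMeasure]
    (hu : Continuous u) {x : X} (hx : u x ≠ 0) : frameOperator μ u ≠ 0 := by
  intro h
  have hpos : 0 < ∫ y, ‖⟪u x, u y⟫_ℂ‖ ^ 2 ∂μ :=
    Continuous.integral_pos_of_hasCompactSupport_nonneg_nonzero (x := x) (by fun_prop)
      (.of_compactSpace _) (fun y => by positivity) (by simpa using hx)
  have hinner : ⟪u x, frameOperator μ u (u x)⟫_ℂ = ↑(∫ y, ‖⟪u x, u y⟫_ℂ‖ ^ 2 ∂μ) := by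
    rw [inner_frameOperator_apply μ hu, ← integral_complex_ofReal]
    refine integral_congr_ae (.of_forall fun y => ?_)
    simp only [← inner_conj_symm (u y) (u x), Complex.conj_mul', Complex.ofReal_pow]
  rw [h, zero_apply, inner_zero_right] at hinner
  exact hpos.ne (Complex.ofReal_injective hinner)

theorem isCompactOperator_frameOperator [CompleteSpace H] [IsProbabilityMeasure μ]
    (hu : Continuous u) : IsCompactOperator (frameOperator μ u) := by
  have hrank : ∀ x, IsCompactOperator (rankOne ℂ (u x) (u x)) := fun x =>
    (isCompactOperator_of_locallyCompactSpace_rng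
      (ContinuousLinearMap.toSpanSingleton ℂ (u x))).comp_clm (innerSL ℂ (u x))
  exact ((compactOperator (RingHom.id ℂ) H H).restrictScalars ℝ).convex.integral_mem
    isClosed_setOfPred_isCompactOperator (.of_forall hrank) (integrable_rankOne μ hu)

theorem frameOperator_apply_mem [CompleteSpace H] [IsProbabilityMeasure μ]
    (hu : Continuous u) {K : Submodule ℂ H} (hK : IsClosed (K : Set H))
    (huK : ∀ x, u x ∈ K) (w : H) : frameOperator μ u w ∈ K := by
  rw [frameOperator_apply μ hu]
  exact (K.restrictScalars ℝ).convex.integral_mem hK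
    (.of_forall fun x => K.smul_mem _ (huK x)) (integrable_inner_smul μ hu w)

theorem frameOperator_comm [IsFiniteMeasureOnCompacts μ] (hu : Continuous u)
    {φ : X ≃ᵐ X} (hφ : MeasurePreserving φ μ μ) {U : H ≃ₗᵢ[ℂ] H} (hU : ∀ x, u (φ x) = U (u x))
    (w : H) : frameOperator μ u (U w) = U (frameOperator μ u w) := by
  calc frameOperator μ u (U w)
      = ∫ x, ⟪u (φ x), U w⟫_ℂ • u (φ x) ∂μ := by
        rw [frameOperator_apply μ hu, hφ.integral_comp' (fun x => ⟪u x, U w⟫_ℂ • u x)]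
    _ = ∫ x, U.toContinuousLinearEquiv (⟪u x, w⟫_ℂ • u x) ∂μ := by
        simp [hU, LinearIsometryEquiv.inner_map_map]
    _ = U (frameOperator μ u w) := by
        rw [ContinuousLinearEquiv.integral_comp_comm, frameOperator_apply μ hu]
        rfl

end FrameOperator

theorem map_mem_orthogonal_of_forall_map_mem {𝕜 G H : Type*} [RCLike 𝕜] [Group G]
    [NormedAddCommGroup H] [InnerProductSpace 𝕜 H] {π : G →* (H ≃ₗᵢ[𝕜] H)} {E : Submodule 𝕜 H}
    (hE : ∀ x, ∀ v ∈ E, π x v ∈ E) (x : G) {v : H} (hv : v ∈ Eᗮ) : π x v ∈ Eᗮ := fun w hw => by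
  have hinv : π x⁻¹ (π x v) = v := by
    rw [← Function.comp_apply (f := π x⁻¹), ← LinearIsometryEquiv.coe_mul, ← map_mul,
      inv_mul_cancel, map_one, LinearIsometryEquiv.coe_one, id_eq]
  rw [← (π x⁻¹).inner_map_map, hinv]
  exact hv _ (hE x⁻¹ w hw)

section Representation

variable {G H : Type*} [Group G] [NormedAddCommGroup H] [InnerProductSpace ℂ H]
  {π : G →* (H ≃ₗᵢ[ℂ] H)}

theorem exists_character_of_forall_smul [TopologicalSpace G] {v : H} (hv0 : v ≠ 0)
    (hv : Continuous fun x => π x v) (h : ∀ x, ∃ c : ℂ, π x v = c • v) :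
    ∃ χ : G →ₜ* Circle, ∀ x, π x v = (χ x : ℂ) • v := by
  choose c hc using h
  have hnorm : ∀ x, ‖c x‖ = 1 := fun x => by
    have := (π x).norm_map v
    rw [hc, norm_smul] at this
    exact (mul_eq_right₀ (norm_ne_zero_iff.2 hv0)).1 this
  have hcont : Continuous c := by
    have : c = fun x => ⟪v, π x v⟫_ℂ / ⟪v, v⟫_ℂ := funext fun x => by
      rw [hc, inner_smul_right, mul_div_cancel_right₀ _ (inner_self_ne_zero.2 hv0)]
    rw [this]
    fun_prop
  have hmul : ∀ x y, c (x * y) = c x * c y := fun x y => smul_left_injective ℂ hv0 <| by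
    change c (x * y) • v = (c x * c y) • v
    rw [← hc, map_mul, LinearIsometryEquiv.coe_mul, Function.comp_apply, hc y, map_smul, hc x,
      smul_smul, mul_comm]
  exact ⟨⟨MonoidHom.mk' (fun x => ⟨c x, mem_sphere_zero_iff_norm.2 (hnorm x)⟩)
    fun x y => Circle.ext (hmul x y), hcont.subtype_mk _⟩, hc⟩

theorem exists_finiteDimensional_invariant_le [TopologicalSpace G] [IsTopologicalGroup G]
    [CompactSpace G] [CompleteSpace H] (hπ : ∀ v, Continuous fun x => π x v) {K : Submodule ℂ H}
    (hK : IsClosed (K : Set H)) (hKπ : ∀ x, ∀ v ∈ K, π x v ∈ K) (hK0 : K ≠ ⊥) :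
    ∃ p ≤ K, p ≠ ⊥ ∧ FiniteDimensional ℂ p ∧ ∀ x, ∀ v ∈ p, π x v ∈ p := by
  borelize G
  let μ : Measure G := Measure.haarMeasure ⊤
  have : IsProbabilityMeasure μ := ⟨Measure.haarMeasure_self⟩
  obtain ⟨v, hv, hv0⟩ := K.exists_mem_ne_zero_of_ne_bot hK0
  let A := frameOperator μ fun x => π x v
  have hcompact : IsCompactOperator A := isCompactOperator_frameOperator μ (hπ v)
  have hcomm : ∀ y w, A (π y w) = π y (A w) := fun y =>
    frameOperator_comm μ (hπ v) (φ := MeasurableEquiv.mulLeft y) (measurePreserving_mul_left μ y)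
      (fun x => congrArg (· v) (map_mul π y x))
  obtain ⟨c, hc, hc0⟩ : ∃ c, Module.End.HasEigenvalue (A : Module.End ℂ H) c ∧ c ≠ 0 := by
    by_contra! h
    exact frameOperator_ne_zero μ (hπ v) (x := 1) (by simpa using hv0)
      ((ContinuousLinearMap.eq_zero_of_forall_hasEigenvalue_eq_zero hcompact
        (isSymmetric_frameOperator μ (hπ v))).1 h)
  refine ⟨Module.End.eigenspace (A : Module.End ℂ H) c, fun w hw => ?_, hc,
    ContinuousLinearMap.finite_dimensional_eigenspace hcompact c hc0, fun x w hw => ?_⟩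
  · have hAw : A w = c • w := Module.End.mem_eigenspace_iff.1 hw
    rw [← inv_smul_smul₀ hc0 w, ← hAw]
    exact K.smul_mem _ (frameOperator_apply_mem μ (hπ v) hK (fun x => hKπ x v hv) w)
  · have hAw : A w = c • w := Module.End.mem_eigenspace_iff.1 hw
    refine Module.End.mem_eigenspace_iff.2 ?_
    rw [ContinuousLinearMap.coe_coe, hcomm, hAw, map_smul]

end Representation

section CommRepresentation

variable {G H : Type*} [CommGroup G] [TopologicalSpace G] [IsTopologicalGroup G] [CompactSpace G]
  [NormedAddCommGroup H] [InnerProductSpace ℂ H] [CompleteSpace H] {π : G →* (H ≃ₗᵢ[ℂ] H)}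

theorem exists_character_eigenvector_mem (hπ : ∀ v, Continuous fun x => π x v) {K : Submodule ℂ H}
    (hK : IsClosed (K : Set H)) (hKπ : ∀ x, ∀ v ∈ K, π x v ∈ K) (hK0 : K ≠ ⊥) :
    ∃ χ : G →ₜ* Circle, ∃ v ∈ K, v ≠ 0 ∧ ∀ x, π x v = (χ x : ℂ) • v := by
  obtain ⟨p, hpK, hp0, _, hpπ⟩ := exists_finiteDimensional_invariant_le hπ hK hKπ hK0
  have hcomm : ∀ x y, Commute ((π x).toLinearEquiv : Module.End ℂ H) (π y).toLinearEquiv :=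
    fun x y => LinearMap.ext fun w => congrArg (· w) ((Commute.all x y).map π).eq
  obtain ⟨v, hv, hv0, heig⟩ := exists_common_eigenvector_of_commute hcomm hp0 hpπ
  obtain ⟨χ, hχ⟩ := exists_character_of_forall_smul hv0 (hπ v) heig
  exact ⟨χ, v, hpK hv, hv0, hχ⟩

theorem exists_character_ne_one_of_map_ne_one (hπ : ∀ v, Continuous fun x => π x v) {g : G}
    (hg : π g ≠ 1) : ∃ χ : G →ₜ* Circle, χ g ≠ 1 := by
  let E := LinearMap.eqLocus (π g).toLinearEquiv.toLinearMap LinearMap.id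
  have hEclosed : IsClosed (E : Set H) := isClosed_eq (π g).continuous continuous_id
  have : CompleteSpace E := hEclosed.completeSpace_coe
  have hEπ : ∀ x, ∀ v ∈ E, π x v ∈ E := fun x v hv => by
    have hcomm : π g (π x v) = π x (π g v) := congrArg (· v) ((Commute.all g x).map π).eq
    exact hcomm.trans (congrArg (π x) hv)
  have hE0 : Eᗮ ≠ ⊥ := fun h => hg <| LinearIsometryEquiv.ext fun v =>
    (Submodule.orthogonal_eq_bot_iff.1 h ▸ Submodule.mem_top : v ∈ E)
  obtain ⟨χ, v, hv, hv0, hχ⟩ := exists_character_eigenvector_mem hπ E.isClosed_orthogonal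
    (fun x _ => map_mem_orthogonal_of_forall_map_mem hEπ x) hE0
  refine ⟨χ, fun h => hv0 ?_⟩
  have hvE : v ∈ E := (hχ g).trans (by rw [h, Circle.coe_one, one_smul]; rfl)
  exact inner_self_eq_zero.1 (hv v hvE)

end CommRepresentation

section RegularRepresentation

variable {G : Type*} [Group G] [MeasurableSpace G]

/-- The left regular representation `(x, f) ↦ f (x⁻¹ * ·)` on `L²(G)`, for a left invariant
measure on `G`. -/
noncomputable def leftRegularRepresentation [MeasurableMul G] (μ : Measure G)
    [μ.IsMulLeftInvariant] : G →* (Lp ℂ 2 μ ≃ₗᵢ[ℂ] Lp ℂ 2 μ) where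
  toFun x := ⟨DistribMulAction.toLinearEquiv ℂ (Lp ℂ 2 μ) (DomMulAct.mk x⁻¹),
    DomMulAct.norm_smul_Lp _⟩
  map_one' := LinearIsometryEquiv.ext fun f => by
    change DomMulAct.mk (1 : G)⁻¹ • f = f
    rw [inv_one, DomMulAct.mk_one, one_smul]
  map_mul' x y := LinearIsometryEquiv.ext fun f => by
    change DomMulAct.mk (x * y)⁻¹ • f = DomMulAct.mk x⁻¹ • DomMulAct.mk y⁻¹ • f
    rw [mul_inv_rev, DomMulAct.mk_mul, mul_smul]

variable [TopologicalSpace G] [IsTopologicalGroup G] [BorelSpace G] {μ : Measure G}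
  [μ.IsMulLeftInvariant]

theorem continuous_leftRegularRepresentation_apply [IsLocallyFiniteMeasure μ]
    [μ.InnerRegularCompactLTTop] (f : Lp ℂ 2 μ) :
    Continuous fun x => leftRegularRepresentation μ x f := by
  have : Fact ((2 : ℝ≥0∞) ≠ ∞) := ⟨ENNReal.ofNat_ne_top⟩
  exact (DomMulAct.continuous_mk.comp continuous_inv).smul continuous_const

theorem apply_inv_mul_of_leftRegularRepresentation_eq_one [CompactSpace G] [IsFiniteMeasure μ]
    [μ.IsOpenPosMeasure] {g : G} (hg : leftRegularRepresentation μ g = 1) (f : C(G, ℂ)) (x : G) :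
    f (g⁻¹ * x) = f x := by
  have h : ContinuousMap.toLp 2 μ ℂ (f.comp ⟨(g⁻¹ * ·), continuous_const_mul g⁻¹⟩) =
      ContinuousMap.toLp 2 μ ℂ f := congrArg (· (ContinuousMap.toLp 2 μ ℂ f)) hg
  exact DFunLike.congr_fun (ContinuousMap.toLp_injective μ h) x

end RegularRepresentation

theorem exists_continuousMap_complex_apply_ne {X : Type*} [TopologicalSpace X]
    [CompletelyRegularSpace X] {x y : X} (hxy : ¬Inseparable x y) :
    ∃ f : C(X, ℂ), f x ≠ f y := by
  by_contra! h
  refine hxy (specializes_iff_inseparable.1 (specializes_iff_mem_closure.2 ?_))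
  by_contra hx
  obtain ⟨f, hf, hfy, hfx⟩ :=
    CompletelyRegularSpace.completely_regular y (closure {x}) isClosed_closure hx
  have := h ⟨fun z => ((f z : ℝ) : ℂ), by fun_prop⟩
  simp [hfy, hfx (subset_closure rfl)] at this

theorem exists_character_apply_ne {G : Type*} [CommGroup G] [TopologicalSpace G]
    [IsTopologicalGroup G] [CompactSpace G] {x y : G} (hxy : ¬Inseparable x y) :
    ∃ χ : G →ₜ* Circle, χ x ≠ χ y := by
  borelize G
  obtain ⟨f, hf⟩ := exists_continuousMap_complex_apply_ne hxy
  have hg : leftRegularRepresentation (Measure.haarMeasure ⊤) (y * x⁻¹) ≠ 1 := fun h =>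
    hf (by simpa using apply_inv_mul_of_leftRegularRepresentation_eq_one h f y)
  obtain ⟨χ, hχ⟩ :=
    exists_character_ne_one_of_map_ne_one continuous_leftRegularRepresentation_apply hg
  exact ⟨χ, fun h => hχ (by rw [map_mul, ← h, ← map_mul, mul_inv_cancel, map_one])⟩

section StoneWeierstrass

variable {X : Type*} (𝕜 : Type*) [TopologicalSpace X] [CompactSpace X] [RCLike 𝕜]

variable (X) in
/-- Pullback of continuous functions along `X → SeparationQuotient X`; it reduces approximation on a
possibly non-Hausdorff `X` to a Hausdorff space. -/
noncomputable def separationQuotientPullback : C(SeparationQuotient X, 𝕜) →⋆ₐ[𝕜] (X →ᵇ 𝕜) where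
  toFun f := .mkOfCompact (f.comp ⟨SeparationQuotient.mk, SeparationQuotient.continuous_mk⟩)
  map_one' := rfl
  map_mul' _ _ := rfl
  map_zero' := rfl
  map_add' _ _ := rfl
  commutes' _ := rfl
  map_star' _ := rfl

theorem continuous_separationQuotientPullback : Continuous (separationQuotientPullback X 𝕜) :=
  (ContinuousMap.isometryEquivBoundedOfCompact X 𝕜).continuous.comp
    (ContinuousMap.continuous_precomp _)

theorem separationQuotientPullback_surjective :
    Function.Surjective (separationQuotientPullback X 𝕜) := fun f =>
  ⟨⟨SeparationQuotient.lift f fun _ _ h => (h.map f.continuous).eq,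
    SeparationQuotient.continuous_lift f.continuous⟩, rfl⟩

variable {𝕜}

theorem starSubalgebra_topologicalClosure_eq_top_of_forall_not_inseparable
    {A : StarSubalgebra 𝕜 (X →ᵇ 𝕜)} (hA : ∀ x y, ¬Inseparable x y → ∃ f ∈ A, f x ≠ f y) :
    A.topologicalClosure = ⊤ := by
  have : CompactSpace (SeparationQuotient X) :=
    SeparationQuotient.surjective_mk.compactSpace SeparationQuotient.continuous_mk
  have hsep : (A.comap (separationQuotientPullback X 𝕜)).SeparatesPoints := by
    intro x y hxy
    obtain ⟨x, rfl⟩ := SeparationQuotient.surjective_mk x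
    obtain ⟨y, rfl⟩ := SeparationQuotient.surjective_mk y
    obtain ⟨f, hf, hfxy⟩ := hA x y fun h => hxy (SeparationQuotient.mk_eq_mk.2 h)
    obtain ⟨u, rfl⟩ := separationQuotientPullback_surjective 𝕜 f
    exact ⟨u, ⟨u, hf, rfl⟩, hfxy⟩
  have hdense := ContinuousMap.starSubalgebra_topologicalClosure_eq_top_of_separatesPoints _ hsep
  refine eq_top_iff.2 fun f _ => ?_
  obtain ⟨u, rfl⟩ := separationQuotientPullback_surjective 𝕜 f
  have hu : u ∈ (A.comap (separationQuotientPullback X 𝕜)).topologicalClosure :=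
    hdense ▸ StarSubalgebra.mem_top
  exact map_mem_closure (continuous_separationQuotientPullback 𝕜) hu fun _ => id

theorem adjoin_topologicalClosure_eq_top_of_forall_not_inseparable {s : Set (X →ᵇ 𝕜)}
    (hstar : star s ⊆ s) (hs : ∀ x y, ¬Inseparable x y → ∃ f ∈ s, f x ≠ f y) :
    (Algebra.adjoin 𝕜 s).topologicalClosure = ⊤ := by
  have hadjoin : (StarAlgebra.adjoin 𝕜 s).toSubalgebra = Algebra.adjoin 𝕜 s := by
    rw [StarAlgebra.adjoin_toSubalgebra, Set.union_eq_left.2 hstar]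
  have hdense : (StarAlgebra.adjoin 𝕜 s).topologicalClosure = ⊤ :=
    starSubalgebra_topologicalClosure_eq_top_of_forall_not_inseparable fun x y hxy =>
      (hs x y hxy).imp fun f hf => ⟨StarAlgebra.subset_adjoin 𝕜 s hf.1, hf.2⟩
  rw [← hadjoin, ← StarSubalgebra.topologicalClosure_toSubalgebra_comm, hdense,
    StarSubalgebra.top_toSubalgebra]

end StoneWeierstrass

/-- A continuous character of `G` as a bounded complex-valued function. -/
noncomputable def characterFunction {G : Type*} [Monoid G] [TopologicalSpace G]
    (χ : G →ₜ* Circle) : G →ᵇ ℂ :=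
  .ofNormedAddCommGroup (fun x => (χ x : ℂ)) (by fun_prop) 1 fun x => (Circle.norm_coe _).le

theorem star_characterFunction {G : Type*} [Monoid G] [TopologicalSpace G] (χ : G →ₜ* Circle) :
    star (characterFunction χ) = characterFunction χ⁻¹ :=
  BoundedContinuousFunction.ext fun x => (Circle.coe_inv_eq_conj (χ x)).symm

theorem adjoin_range_characterFunction_topologicalClosure_eq_top {G : Type*} [CommGroup G]
    [TopologicalSpace G] [IsTopologicalGroup G] [CompactSpace G] :
    (Algebra.adjoin ℂ (Set.range (characterFunction (G := G)))).topologicalClosure = ⊤ := by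
  refine adjoin_topologicalClosure_eq_top_of_forall_not_inseparable ?_ fun x y hxy => ?_
  · rintro f ⟨χ, hχ⟩
    exact ⟨χ⁻¹, by rw [← star_characterFunction, hχ, star_star]⟩
  · obtain ⟨χ, hχ⟩ := exists_character_apply_ne hxy
    exact ⟨characterFunction χ, ⟨χ, rfl⟩, fun h => hχ (Circle.ext h)⟩

section CharacterSpace

variable {𝕜 A : Type*} [NontriviallyNormedField 𝕜] [NormedRing A] [NormedAlgebra 𝕜 A]
  (φ : WeakDual.characterSpace 𝕜 A) {a b : A}

theorem norm_characterSpace_apply_le_one (ha : ‖a‖ ≤ 1) : ‖φ a‖ ≤ 1 := by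
  -- `A` need not be complete, so `AlgHom.norm_apply_le_self` is not available.
  by_contra! h
  obtain ⟨n, hn⟩ := pow_unbounded_of_one_lt ‖WeakDual.CharacterSpace.toCLM φ‖ h
  refine (hn.trans_le (pow_le_pow_right₀ h.le n.le_succ)).not_ge ?_
  calc ‖φ a‖ ^ (n + 1) = ‖WeakDual.CharacterSpace.toCLM φ (a ^ (n + 1))‖ := by
        rw [← norm_pow, ← map_pow, WeakDual.CharacterSpace.coe_toCLM]
    _ ≤ ‖WeakDual.CharacterSpace.toCLM φ‖ := ContinuousLinearMap.unit_le_opNorm _ _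
        ((norm_pow_le' a n.succ_pos).trans (pow_le_one₀ (norm_nonneg a) ha))

theorem norm_characterSpace_apply_eq_one (ha : ‖a‖ ≤ 1) (hb : ‖b‖ ≤ 1) (hab : a * b = 1) :
    ‖φ a‖ = 1 := by
  have hmul : ‖φ a‖ * ‖φ b‖ = 1 := by rw [← norm_mul, ← map_mul, hab, map_one, norm_one]
  refine (norm_characterSpace_apply_le_one φ ha).antisymm ?_
  rw [← hmul]
  exact mul_le_of_le_one_right (norm_nonneg _) (norm_characterSpace_apply_le_one φ hb)

end CharacterSpace

namespace WeylAlgebra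

variable {S : Type*} [Semigroup S] [TopologicalSpace S] [SeparatelyContinuousMul S]

theorem const_mem_F (k : ℕ) {c : ℂ} (hc : ‖c‖ = 1) :
    BoundedContinuousFunction.const S c ∈ F S k := by
  induction k generalizing c with
  | zero => exact ⟨c, hc, rfl⟩
  | succ k ih =>
    refine ⟨(LMC S).algebraMap_mem c, fun _ => hc, fun μ =>
      ⟨BoundedContinuousFunction.const S 1, ih norm_one, fun s => ?_⟩⟩
    have hT : T μ ⟨BoundedContinuousFunction.const S c, (LMC S).algebraMap_mem c⟩ s = c :=
      AlgHomClass.commutes μ c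
    rw [hT, BoundedContinuousFunction.const_apply, BoundedContinuousFunction.const_apply, one_mul]

theorem leftTranslate_of_map_mul {f : S →ᵇ ℂ} (hmul : ∀ x y, f (x * y) = f x * f y) (s : S) :
    leftTranslate s f = f s • f :=
  BoundedContinuousFunction.ext (hmul s)

theorem mem_LMC_of_map_mul {f : S →ᵇ ℂ} (hmul : ∀ x y, f (x * y) = f x * f y) : f ∈ LMC S := by
  intro μ
  simp only [leftTranslate_of_map_mul hmul, map_smul]
  fun_prop

theorem norm_characterSpace_LMC_apply_eq_one (μ : WeakDual.characterSpace ℂ (LMC S)) {f : LMC S}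
    (hf : ∀ s, ‖(f : S →ᵇ ℂ) s‖ = 1) : ‖μ f‖ = 1 := by
  have hnorm : ‖f‖ ≤ 1 := (BoundedContinuousFunction.norm_le zero_le_one).2 fun s => (hf s).le
  refine norm_characterSpace_apply_eq_one μ hnorm ((norm_star f).trans_le hnorm) ?_
  ext s
  exact (Complex.mul_conj' _).trans (by simp [hf])

theorem mem_F_succ_of_map_mul (k : ℕ) {f : S →ᵇ ℂ} (hmul : ∀ x y, f (x * y) = f x * f y)
    (hf : ∀ s, ‖f s‖ = 1) : f ∈ F S (k + 1) := by
  let f' : LMC S := ⟨f, mem_LMC_of_map_mul hmul⟩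
  refine ⟨f'.2, hf, fun μ => ⟨BoundedContinuousFunction.const S (μ f'),
    const_mem_F k (norm_characterSpace_LMC_apply_eq_one μ hf), fun s => ?_⟩⟩
  calc T μ f' s = μ (f s • f') := congrArg μ (Subtype.ext (leftTranslate_of_map_mul hmul s))
    _ = μ f' * f s := by rw [map_smul, smul_eq_mul, mul_comm]

variable (S) in
theorem Wk_le_W {k : ℕ} (hk : 1 ≤ k) : Wk S k ≤ W S :=
  Subalgebra.topologicalClosure_mono (Algebra.adjoin_mono fun _ hf => ⟨k, hk, hf⟩)

theorem Wk_succ_eq_top (G : Type*) [CommGroup G] [TopologicalSpace G] [IsTopologicalGroup G]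
    [CompactSpace G] (k : ℕ) : Wk G (k + 1) = ⊤ := by
  have hF : Set.range characterFunction ⊆ F G (k + 1) := by
    rintro _ ⟨χ, rfl⟩
    exact mem_F_succ_of_map_mul k (fun x y => congrArg ((↑) : Circle → ℂ) (map_mul χ x y))
      fun x => Circle.norm_coe _
  rw [eq_top_iff, ← adjoin_range_characterFunction_topologicalClosure_eq_top]
  exact Subalgebra.topologicalClosure_mono (Algebra.adjoin_mono hF)

end WeylAlgebra

theorem corollary3p8 (G : Type*) [CommGroup G] [TopologicalSpace G] [IsTopologicalGroup G]
    [CompactSpace G] (k : ℕ) (hk : 1 ≤ k) :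
    WeylAlgebra.Wk G k = WeylAlgebra.W G ∧ WeylAlgebra.W G = ⊤ := by
  obtain ⟨k, rfl⟩ := Nat.exists_eq_add_of_le' hk
  have hWk : WeylAlgebra.Wk G (k + 1) = ⊤ := WeylAlgebra.Wk_succ_eq_top G k
  have hW : WeylAlgebra.W G = ⊤ := top_le_iff.1 (hWk ▸ WeylAlgebra.Wk_le_W G hk)
  exact ⟨hWk.trans hW.symm, hW⟩
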